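/- All structures have domain $\omega$. A directed graph $\mathcal{A}=(\omega,E)$ is ($X$-)computable if its edge relation $E\subseteq\omega^2$ is ($X$-)computable. A computable directed graph $\mathcal{A}$ is \emph{computably categorical} if for every computable directed graph $\mathcal{B}\cong\mathcal{A}$ there is a computable isomorphism from $\mathcal{A}$ onto $\mathcal{B}$; for $X\subseteq\omega$, it is \emph{computably categorical relative to $X$} if for every $X$-computable directed graph $\mathcal{B}\cong\mathcal{A}$ there is an $X$-computable isomorphism from $\mathcal{A}$ onto $\mathcal{B}$. A set $G\subseteq\omega$ is \emph{$n$-generic} if for every $\Sigma^0_n$ set of strings $S\subseteq 2^{<\omega}$ there is an $m$ such that either $G\restriction m\in S$, or $\tau\notin S$ for all $\tau\supseteq G\restriction m$; it is \emph{properly $1$-generic} if it is $1$-generic but not $2$-generic. \textbf{Theorem.} There exist a properly $1$-generic set $G$ and a computable directed graph $\mathcal{A}$ such that $\mathcal{A}$ is not computably categorical but is computably categorical relative to $G$. -/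

import Mathlib

/-! Sets of natural numbers are identified with points of Cantor space `ℕ → Bool`
(their characteristic functions); finite binary strings are lists of Booleans. -/

namespace CompCat

/-- The initial segment of `G` of length `m`, as a binary string. -/
def initSeg (G : ℕ → Bool) (m : ℕ) : List Bool :=
  (List.range m).map G

/-- `p` is a `Σ⁰ₙ` predicate: `Σ⁰₀` means computable, and `p` is `Σ⁰ₙ₊₁` if it is of the form
`p a ↔ ∃ k, q (a, k)` with `q` a `Π⁰ₙ` predicate, i.e. with the negation of `q` being `Σ⁰ₙ`. -/
def IsSigma : ℕ → {α : Type} → [Primcodable α] → (α → Prop) → Prop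
  | 0, _, _, p => ComputablePred p
  | n + 1, α, _, p =>
      ∃ q : α × ℕ → Prop, IsSigma n (fun x => ¬ q x) ∧ ∀ a, p a ↔ ∃ k, q (a, k)

/-- `G` is `n`-generic: every `Σ⁰ₙ` set of strings is met or avoided by an initial segment
of `G`. -/
def IsGeneric (n : ℕ) (G : ℕ → Bool) : Prop :=
  ∀ S : Set (List Bool), IsSigma n (fun σ => σ ∈ S) →
    ∃ m : ℕ, initSeg G m ∈ S ∨ ∀ τ : List Bool, initSeg G m <+: τ → τ ∉ S

/-- `G` is properly `1`-generic: it is `1`-generic but not `2`-generic. -/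
def IsProperlyOneGeneric (G : ℕ → Bool) : Prop :=
  IsGeneric 1 G ∧ ¬ IsGeneric 2 G

/-- The oracle given by `X`: its `0`-`1`-valued characteristic function. -/
def oracle (X : ℕ → Bool) : Set (ℕ →. ℕ) :=
  {fun n => Part.some (X n).toNat}

/-- A computable directed graph with domain `ℕ`: its edge relation is decidable by an
algorithm. -/
def IsComputableGraph (A : Digraph ℕ) : Prop :=
  ComputablePred fun p : ℕ × ℕ => A.Adj p.1 p.2

/-- An `X`-computable directed graph with domain `ℕ`. -/
def IsComputableGraphIn (X : ℕ → Bool) (A : Digraph ℕ) : Prop :=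
  ∃ _ : DecidablePred fun p : ℕ × ℕ => A.Adj p.1 p.2,
    ComputableIn (oracle X) fun p : ℕ × ℕ => decide (A.Adj p.1 p.2)

/-- Every computable copy of `A` is isomorphic to `A` by a computable isomorphism. -/
def IsComputablyCategorical (A : Digraph ℕ) : Prop :=
  ∀ B : Digraph ℕ, IsComputableGraph B → Nonempty (A.Adj ≃r B.Adj) →
    ∃ f : A.Adj ≃r B.Adj, Computable f

/-- Every `X`-computable copy of `A` is isomorphic to `A` by an `X`-computable isomorphism. -/
def IsComputablyCategoricalRelTo (X : ℕ → Bool) (A : Digraph ℕ) : Prop :=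
  ∀ B : Digraph ℕ, IsComputableGraphIn X B → Nonempty (A.Adj ≃r B.Adj) →
    ∃ f : A.Adj ≃r B.Adj, ComputableIn (oracle X) f

end CompCat

/-! A coding into `1`-generic sets is combined with a tagging construction on graphs. Positions
`freezePt i` are chosen so that lying off them is a `Σ₁` event (`released`), while the gap after
`freezePt i` has room, for every string ending there, for an extension accepted by program `i` if
there is one. A `1`-generic can thus be built inside the gaps with arbitrary bits at the frozen
positions (`isGeneric_one_genericSet`). The bits placed there say whether the program opposed by the
position halts.

The graph has a rigid spine and two roots for each `n`. The left root is tagged once the opponent of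
`n` halts on it or `n` is released; the right root once `n` is released. At a released `n` the roots
are interchangeable; at a frozen `n` a halting opponent leaves an asymmetric pair. A second
computable copy places that tag only after seeing the opponent's value, on the side that refutes it.
Since `freezePt i` opposes program `i`, no computable isomorphism survives
(`not_isComputablyCategorical_stdGraph`).

The generic `G` repairs this (`exists_computableIn_iso`): if `G n = true`, a tagged root exists and
is searched for; if `G n = false`, the roots are automorphic and either will do. Wrong bits at
released `n` are harmless, so `G` is free there. Finally, `G` has no `1` at a position that is never
activated, although strings with such a `1` form a dense `Σ₂` set, so `G` is not `2`-generic. -/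

namespace CompCat

open Nat.Partrec (Code)
open Encodable Denumerable

/-! ### Sparse markers with `Σ₁` complement -/

/-- One more than the least `s < t` with `p s`, or `0` if there is none. -/
def firstWitness (p : ℕ → Bool) (t : ℕ) : ℕ :=
  Nat.rec 0 (fun s r => if r = 0 ∧ p s = true then s + 1 else r) t

open Classical in
/-- One more than the least `s` with `p s`, or `0` if there is none. -/
noncomputable def witness (p : ℕ → Bool) : ℕ :=
  if h : ∃ s, p s = true then Nat.find h + 1 else 0

theorem firstWitness_eq (p : ℕ → Bool) (t : ℕ) :
    firstWitness p t = if witness p ≤ t then witness p else 0 := by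
  induction t with
  | zero =>
    simp only [firstWitness, Nat.le_zero]
    split_ifs with h <;> simp [h]
  | succ t ih =>
    have hstep : firstWitness p (t + 1) =
        if firstWitness p t = 0 ∧ p t = true then t + 1 else firstWitness p t := rfl
    rw [hstep, ih]
    by_cases h : ∃ s, p s = true
    · have hw : witness p = Nat.find h + 1 := by simp [witness, h]
      rw [hw]
      rcases lt_trichotomy (Nat.find h) t with h1 | h1 | h1
      · rw [if_pos (by omega : Nat.find h + 1 ≤ t), if_pos (by omega : Nat.find h + 1 ≤ t + 1)]
        simp
      · have hs := Nat.find_spec h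
        rw [h1] at hs ⊢
        simp [hs]
      · have hp := Nat.find_min h h1
        rw [if_neg (by omega : ¬ Nat.find h + 1 ≤ t), if_neg (by omega : ¬ Nat.find h + 1 ≤ t + 1)]
        simp [hp]
    · have hw : witness p = 0 := by simp [witness, h]
      have hp : ¬ p t = true := fun h' => h ⟨t, h'⟩
      simp [hw, hp]

theorem exists_of_witness {p : ℕ → Bool} {s : ℕ} (hs : p s = true) :
    ∃ y, p y = true ∧ y + 1 = witness p := by
  have h : ∃ s, p s = true := ⟨s, hs⟩
  exact ⟨Nat.find h, Nat.find_spec h, by simp [witness, h]⟩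

theorem primrec_firstWitness {α : Type*} [Primcodable α] {p : α → ℕ → Bool} {f : α → ℕ}
    (hp : Primrec₂ p) (hf : Primrec f) : Primrec fun a => firstWitness (p a) (f a) := by
  refine Primrec.nat_rec' (h := fun a q => if q.2 = 0 ∧ p a q.1 = true then q.1 + 1 else q.2)
    hf (Primrec.const 0) ?_
  refine Primrec.ite ?_ (Primrec.succ.comp (Primrec.fst.comp Primrec.snd))
    (Primrec.snd.comp Primrec.snd)
  exact (Primrec.eq.comp (Primrec.snd.comp Primrec.snd) (Primrec.const 0)).and
    (Primrec.eq.comp (hp.comp Primrec.fst (Primrec.fst.comp Primrec.snd)) (Primrec.const true))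

section Markers

variable (P : ℕ → ℕ → ℕ → Bool) (F : ℕ → ℕ)

/-- The stage `t` approximation of a bound on the first witnesses of `P i x`, for `x < b`. -/
def modulus (i b t : ℕ) : ℕ := ∑ x ∈ Finset.range b, firstWitness (P i x) t

/-- A bound on the first witnesses of `P i x`, for `x < b`. -/
noncomputable def limModulus (i b : ℕ) : ℕ := ∑ x ∈ Finset.range b, witness (P i x)

/-- A sum dominates each summand, so the limit value is itself a stage by which every witness
involved has appeared. -/
theorem modulus_eq {i b t : ℕ} (h : limModulus P i b ≤ t) :
    modulus P i b t = limModulus P i b := by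
  refine Finset.sum_congr rfl fun x hx => ?_
  rw [firstWitness_eq, if_pos]
  exact (Finset.single_le_sum (f := fun x => witness (P i x)) (fun _ _ => Nat.zero_le _) hx).trans h

/-- The position of the `i`-th marker at stage `t`. -/
def marker (t i : ℕ) : ℕ :=
  Nat.rec 0 (fun i n => Nat.pair (i + 1) (n + 1 + modulus P i (F n) t)) i

/-- The final position of the `i`-th marker. -/
noncomputable def limMarker (i : ℕ) : ℕ :=
  Nat.rec 0 (fun i n => Nat.pair (i + 1) (n + 1 + limModulus P i (F n))) i

theorem limMarker_succ_ge (i : ℕ) :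
    limMarker P F i + 1 + limModulus P i (F (limMarker P F i)) ≤ limMarker P F (i + 1) :=
  Nat.right_le_pair _ _

theorem limMarker_strictMono : StrictMono (limMarker P F) :=
  strictMono_nat_of_lt_succ fun i => by have := limMarker_succ_ge P F i; omega

/-- A position carries its own index, so the only marker that could rest on `n` is known in advance.
-/
theorem unpair_limMarker (i : ℕ) : (limMarker P F i).unpair.1 = i := by
  cases i with
  | zero => simp [limMarker]
  | succ i => simp [limMarker]

/-- A final position bounds the preceding position and the modulus it was computed from, so it is
also a bound on its own settling time. -/
theorem marker_eq {t i : ℕ} (h : limMarker P F i ≤ t) : marker P F t i = limMarker P F i := by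
  induction i with
  | zero => rfl
  | succ i ih =>
    have h1 := limMarker_succ_ge P F i
    have h2 : marker P F t i = limMarker P F i := ih (by omega)
    have h3 : marker P F t (i + 1) =
      Nat.pair (i + 1) (marker P F t i + 1 + modulus P i (F (marker P F t i)) t) := rfl
    rw [h3, h2, modulus_eq P (by omega)]
    rfl

/-- At stage `t`, `n` is seen not to be the final position of a marker. -/
def discarded (n t : ℕ) : Bool := decide (n ≤ t ∧ marker P F t n.unpair.1 ≠ n)

/-- A true final position `n` is already correct at every stage `t ≥ n`; a false one is exposed at
any stage beyond both it and the true position. This makes the complement of the markers `Σ₁`. -/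
theorem not_discarded_iff (n : ℕ) :
    (¬ ∃ t, discarded P F n t = true) ↔ n = limMarker P F n.unpair.1 := by
  simp only [discarded, decide_eq_true_eq, not_exists, not_and, not_not]
  constructor
  · intro h
    rw [← marker_eq P F (le_max_right n _), h _ (le_max_left _ _)]
  · intro h t ht
    rw [marker_eq P F (by omega), ← h]

theorem not_discarded_limMarker (i : ℕ) : ¬ ∃ t, discarded P F (limMarker P F i) t = true := by
  rw [not_discarded_iff, unpair_limMarker]

theorem exists_witness_le {i x s : ℕ} (hx : x < F (limMarker P F i)) (hs : P i x s = true) :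
    ∃ y, P i x y = true ∧ limMarker P F i + 1 + y ≤ limMarker P F (i + 1) := by
  obtain ⟨y, hy, hw⟩ := exists_of_witness hs
  have h1 := limMarker_succ_ge P F i
  have h2 : witness (P i x) ≤ limModulus P i (F (limMarker P F i)) :=
    Finset.single_le_sum (f := fun x => witness (P i x)) (fun _ _ => Nat.zero_le _)
      (Finset.mem_range.2 hx)
  exact ⟨y, hy, by omega⟩

variable {P F}

theorem primrec_modulus (hP : Primrec fun a : (ℕ × ℕ) × ℕ => P a.1.1 a.1.2 a.2) :
    Primrec fun a : (ℕ × ℕ) × ℕ => modulus P a.1.1 a.1.2 a.2 := by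
  have h : Primrec fun a : (ℕ × ℕ) × ℕ =>
      (Nat.rec 0 (fun x r => r + firstWitness (P a.1.1 x) a.2) a.1.2 : ℕ) := by
    refine Primrec.nat_rec' (h := fun a q => q.2 + firstWitness (P a.1.1 q.1) a.2)
      (Primrec.snd.comp Primrec.fst) (Primrec.const 0) ?_
    refine Primrec.nat_add.comp (Primrec.snd.comp Primrec.snd) ?_
    refine primrec_firstWitness (p := fun (b : ((ℕ × ℕ) × ℕ) × ℕ × ℕ) s => P b.1.1.1 b.2.1 s) ?_
      (Primrec.snd.comp Primrec.fst)
    exact hP.comp (Primrec.pair (Primrec.pair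
      (Primrec.fst.comp (Primrec.fst.comp (Primrec.fst.comp Primrec.fst)))
      (Primrec.fst.comp (Primrec.snd.comp Primrec.fst))) Primrec.snd)
  refine h.of_eq fun a => ?_
  rw [modulus]
  induction a.1.2 with
  | zero => rfl
  | succ b ih => rw [Finset.sum_range_succ, ← ih]

theorem primrec_marker (hP : Primrec fun a : (ℕ × ℕ) × ℕ => P a.1.1 a.1.2 a.2)
    (hF : Primrec F) : Primrec₂ (marker P F) := by
  refine Primrec.nat_rec' (f := Prod.snd) (g := fun _ => 0)
    (h := fun a q => Nat.pair (q.1 + 1) (q.2 + 1 + modulus P q.1 (F q.2) a.1))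
    Primrec.snd (Primrec.const 0) ?_
  have h1 : Primrec fun b : (ℕ × ℕ) × ℕ × ℕ => b.2.1 := Primrec.fst.comp Primrec.snd
  have h2 : Primrec fun b : (ℕ × ℕ) × ℕ × ℕ => b.2.2 := Primrec.snd.comp Primrec.snd
  exact Primrec₂.natPair.comp (Primrec.succ.comp h1)
    (Primrec.nat_add.comp (Primrec.succ.comp h2)
      ((primrec_modulus hP).comp
        (Primrec.pair (Primrec.pair h1 (hF.comp h2)) (Primrec.fst.comp Primrec.fst))))

theorem primrec_discarded (hP : Primrec fun a : (ℕ × ℕ) × ℕ => P a.1.1 a.1.2 a.2)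
    (hF : Primrec F) : Primrec₂ (discarded P F) := by
  refine PrimrecPred.decide (p := fun a : ℕ × ℕ => a.1 ≤ a.2 ∧ marker P F a.2 a.1.unpair.1 ≠ a.1)
    ?_
  refine (Primrec.nat_le.comp Primrec.fst Primrec.snd).and (PrimrecPred.not ?_)
  exact Primrec.eq.comp ((primrec_marker hP hF).comp Primrec.snd
    (Primrec.fst.comp (Primrec.unpair.comp Primrec.fst))) Primrec.fst

end Markers

/-! ### Frozen positions for the acceptance predicate -/

/-- A bound on the codes of binary strings of length `n`. -/
def codeBound (n : ℕ) : ℕ := Nat.rec 0 (fun _ r => Nat.succ (Nat.pair 1 r)) n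

theorem encode_le_codeBound (l : List Bool) : encode l ≤ codeBound l.length := by
  induction l with
  | nil => simp [codeBound]
  | cons b l ih =>
    rw [encode_list_cons]
    have hl : StrictMono fun a => Nat.pair a (encode l) := fun _ _ h => Nat.pair_lt_pair_left _ h
    have hr : StrictMono (Nat.pair 1) := fun _ _ h => Nat.pair_lt_pair_right _ h
    have hb : encode b ≤ 1 := by cases b <;> simp
    exact Nat.succ_le_succ ((hl.monotone hb).trans (hr.monotone ih))

theorem primrec_codeBound : Primrec codeBound :=
  Primrec.nat_rec₁ 0 (Primrec.succ.comp
    (Primrec₂.natPair.comp (Primrec.const 1) Primrec.snd))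

/-- The string and the number of steps coded by `y`. -/
def certificate (y : ℕ) : List Bool × ℕ := (decode (α := List Bool × ℕ) y).getD ([], 0)

/-- `y` codes a string `ρ` and a number of steps in which the program with index `i` accepts the
string coded by `x` followed by `ρ`. -/
def accepts (i x y : ℕ) : Bool :=
  decide ((certificate y).1.length ≤ y) &&
  (Code.evaln (certificate y).2 (ofNat Code i)
    (encode ((decode (α := List Bool) x).getD [] ++ (certificate y).1))).isSome

theorem primrec_accepts : Primrec fun a : (ℕ × ℕ) × ℕ => accepts a.1.1 a.1.2 a.2 := by
  have hy : Primrec fun a : (ℕ × ℕ) × ℕ => certificate a.2 :=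
    Primrec.option_getD.comp (Primrec.decode.comp Primrec.snd) (Primrec.const _)
  have hx : Primrec fun a : (ℕ × ℕ) × ℕ => (decode (α := List Bool) a.1.2).getD [] :=
    Primrec.option_getD.comp (Primrec.decode.comp (Primrec.snd.comp Primrec.fst)) (Primrec.const _)
  refine Primrec.and.comp (PrimrecPred.decide (Primrec.nat_le.comp
    (Primrec.list_length.comp (Primrec.fst.comp hy)) Primrec.snd)) ?_
  exact Primrec.option_isSome.comp (Code.primrec_evaln.comp (Primrec.pair (Primrec.pair
    (Primrec.snd.comp hy) ((Primrec.ofNat Code).comp (Primrec.fst.comp Primrec.fst)))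
    (Primrec.encode.comp (Primrec.list_append.comp hx (Primrec.fst.comp hy)))))

/-- A bound on the codes of binary strings of length `n + 1`. -/
def stringBound (n : ℕ) : ℕ := codeBound (n + 1) + 1

theorem primrec_stringBound : Primrec stringBound :=
  Primrec.succ.comp (primrec_codeBound.comp Primrec.succ)

/-- The final position of the `i`-th marker in the construction for `accepts`. -/
noncomputable def freezePt (i : ℕ) : ℕ := limMarker accepts stringBound i

/-- At stage `t`, `n` is seen not to be frozen. -/
def released (n t : ℕ) : Bool := discarded accepts stringBound n t

theorem primrec_released : Primrec₂ released := primrec_discarded primrec_accepts primrec_stringBound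

end CompCat

/-! ### A `1`-generic with prescribed bits at the frozen positions -/

namespace CompCat

open Nat.Partrec (Code)
open Encodable Denumerable

theorem freezePt_strictMono : StrictMono freezePt := limMarker_strictMono _ _

theorem unpair_freezePt (i : ℕ) : (freezePt i).unpair.1 = i := unpair_limMarker _ _ i

theorem not_released_iff (n : ℕ) :
    (¬ ∃ t, released n t = true) ↔ n = freezePt n.unpair.1 := not_discarded_iff _ _ n

theorem not_released_freezePt (i : ℕ) : ¬ ∃ t, released (freezePt i) t = true :=
  not_discarded_limMarker _ _ i

theorem exists_code_of_isSigma_one {S : Set (List Bool)} (h : IsSigma 1 (fun σ => σ ∈ S)) :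
    ∃ c : Code, ∀ σ, σ ∈ S ↔ ∃ k, (Code.evaln k c (encode σ)).isSome := by
  obtain ⟨q, hq, hS⟩ := h
  have hq' : ComputablePred q := by
    have h1 : ComputablePred fun x => ¬ q x := hq
    exact h1.not.of_eq fun a => not_not
  have hre : REPred fun σ => σ ∈ S := by
    obtain ⟨f, hf, rfl⟩ := ComputablePred.computable_iff.1 hq'
    have hp : Partrec fun σ : List Bool => Nat.rfind fun k => Part.some (f (σ, k)) :=
      Partrec.rfind hf.partrec.to₂
    refine hp.dom_re.of_eq fun σ => ?_
    refine Iff.trans ?_ (hS σ).symm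
    exact Nat.rfind_dom.trans (by simp)
  obtain ⟨c, hc⟩ := Code.exists_code.1 hre
  refine ⟨c, fun σ => ?_⟩
  have h1 : σ ∈ S ↔ (Code.eval c (encode σ)).Dom := by
    rw [hc]; simp [Part.assert, Part.bind]
  rw [h1, Part.dom_iff_mem]
  simp only [Code.evaln_complete, Option.isSome_iff_exists, Option.mem_def]
  exact exists_comm

theorem accepts_sound {i y : ℕ} {σ : List Bool} (h : accepts i (encode σ) y = true) :
    (certificate y).1.length ≤ y ∧
      ∃ k, (Code.evaln k (ofNat Code i) (encode (σ ++ (certificate y).1))).isSome := by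
  simp only [accepts, Bool.and_eq_true, decide_eq_true_eq, encodek, Option.getD_some] at h
  exact ⟨h.1, _, h.2⟩

theorem accepts_complete {i k : ℕ} {σ ρ : List Bool}
    (h : (Code.evaln k (ofNat Code i) (encode (σ ++ ρ))).isSome) :
    accepts i (encode σ) (encode (ρ, k)) = true := by
  have hc : certificate (encode (ρ, k)) = (ρ, k) := by simp [certificate]
  have hl : ρ.length ≤ encode (ρ, k) :=
    (length_le_encode ρ).trans (Nat.left_le_pair _ _)
  simp only [accepts, hc, encodek, Option.getD_some, h, hl, decide_true, Bool.and_self]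

open Classical in
/-- An extension of `σ` accepted by the program with index `i`, if there is one, as a suffix to be
appended to `σ`. -/
noncomputable def acceptedSuffix (i : ℕ) (σ : List Bool) : List Bool :=
  if h : ∃ y, accepts i (encode σ) y = true ∧ freezePt i + 1 + y ≤ freezePt (i + 1) then
    (certificate h.choose).1 else []

/-- The certificate itself fits in the gap, and `accepts` demands that the suffix be no longer than
its certificate. -/
theorem length_acceptedSuffix_le (i : ℕ) (σ : List Bool) :
    freezePt i + 1 + (acceptedSuffix i σ).length ≤ freezePt (i + 1) := by
  unfold acceptedSuffix
  split_ifs with h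
  · have h1 := (accepts_sound h.choose_spec.1).1
    have h2 := h.choose_spec.2
    omega
  · simpa using freezePt_strictMono (Nat.lt_succ_self i)

/-- The code of `σ` lies below `stringBound (freezePt i)`, so `σ` is among the strings for which the
gap was sized: searching within the gap loses nothing. -/
theorem acceptedSuffix_spec {i k : ℕ} {σ ρ : List Bool} (hσ : σ.length = freezePt i + 1)
    (h : (Code.evaln k (ofNat Code i) (encode (σ ++ ρ))).isSome) :
    ∃ k, (Code.evaln k (ofNat Code i) (encode (σ ++ acceptedSuffix i σ))).isSome := by
  have hlt : encode σ < stringBound (freezePt i) := by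
    have := encode_le_codeBound σ
    rw [hσ] at this
    exact Nat.lt_succ_of_le this
  have h' : ∃ y, accepts i (encode σ) y = true ∧ freezePt i + 1 + y ≤ freezePt (i + 1) :=
    exists_witness_le accepts stringBound hlt (accepts_complete h)
  have h2 := (accepts_sound h'.choose_spec.1).2
  rw [acceptedSuffix, dif_pos h']
  exact h2

section Generic

variable (Z : ℕ → Bool)

/-- The initial segment up to and including position `freezePt i` of a `1`-generic that agrees
with `Z` at the frozen positions. -/
noncomputable def genericSeg (i : ℕ) : List Bool :=
  Nat.rec [Z 0] (fun i σ => (σ ++ acceptedSuffix i σ ++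
    List.replicate (freezePt (i + 1) - (σ ++ acceptedSuffix i σ).length) false) ++
      [Z (freezePt (i + 1))]) i

theorem genericSeg_succ (i : ℕ) : genericSeg Z (i + 1) =
    (genericSeg Z i ++ acceptedSuffix i (genericSeg Z i) ++
      List.replicate (freezePt (i + 1) -
        (genericSeg Z i ++ acceptedSuffix i (genericSeg Z i)).length) false) ++
      [Z (freezePt (i + 1))] := rfl

theorem length_genericSeg (i : ℕ) : (genericSeg Z i).length = freezePt i + 1 := by
  induction i with
  | zero => rfl
  | succ i ih =>
    have := length_acceptedSuffix_le i (genericSeg Z i)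
    rw [genericSeg_succ]
    simp only [List.length_append, List.length_replicate, List.length_singleton, ih]
    omega

theorem genericSeg_append_prefix (i : ℕ) :
    genericSeg Z i ++ acceptedSuffix i (genericSeg Z i) <+: genericSeg Z (i + 1) := by
  rw [genericSeg_succ, List.append_assoc _ (List.replicate _ _)]
  exact List.prefix_append _ _

theorem genericSeg_prefix {i j : ℕ} (h : i ≤ j) : genericSeg Z i <+: genericSeg Z j := by
  induction j, h using Nat.le_induction with
  | base => exact List.prefix_refl _
  | succ j _ ih =>
    exact ih.trans ((List.prefix_append _ _).trans (genericSeg_append_prefix Z j))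

theorem genericSeg_last (i : ℕ) : (genericSeg Z i)[freezePt i]? = some (Z (freezePt i)) := by
  cases i with
  | zero => rfl
  | succ i =>
    have h := length_genericSeg Z (i + 1)
    rw [genericSeg_succ] at h ⊢
    rw [List.length_append, List.length_singleton] at h
    rw [List.getElem?_append_right (by omega), Nat.sub_eq_zero_of_le (by omega)]
    rfl

/-- A `1`-generic that agrees with `Z` at the frozen positions. -/
noncomputable def genericSet (p : ℕ) : Bool := (genericSeg Z p).getD p false

theorem getElem?_eq_of_prefix {α : Type*} {l₁ l₂ : List α} (h : l₁ <+: l₂) {p : ℕ}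
    (hp : p < l₁.length) : l₂[p]? = l₁[p]? := by
  obtain ⟨t, rfl⟩ := h
  exact List.getElem?_append_left hp

theorem genericSeg_getElem? {i p : ℕ} (h : p < (genericSeg Z i).length) :
    (genericSeg Z i)[p]? = some (genericSet Z p) := by
  have hp : p < (genericSeg Z p).length := by
    have := freezePt_strictMono.le_apply (x := p)
    rw [length_genericSeg]; omega
  have h1 : (genericSeg Z p)[p]? = some (genericSet Z p) := by
    rw [genericSet, List.getD_eq_getElem?_getD, List.getElem?_eq_getElem hp, Option.getD_some]
  rw [← h1]
  rcases le_total i p with hip | hip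
  · rw [getElem?_eq_of_prefix (genericSeg_prefix Z hip) h]
  · rw [getElem?_eq_of_prefix (genericSeg_prefix Z hip) hp]

theorem initSeg_getElem? (G : ℕ → Bool) (m p : ℕ) (h : p < m) :
    (initSeg G m)[p]? = some (G p) := by
  simp [initSeg, h]

theorem length_initSeg (G : ℕ → Bool) (m : ℕ) : (initSeg G m).length = m := by
  simp [initSeg]

theorem initSeg_eq_of_prefix {i : ℕ} {σ : List Bool} (h : σ <+: genericSeg Z i) :
    initSeg (genericSet Z) σ.length = σ := by
  refine List.ext_getElem? fun p => ?_
  by_cases hp : p < σ.length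
  · rw [initSeg_getElem? _ _ _ hp, ← getElem?_eq_of_prefix h hp,
      genericSeg_getElem? Z (hp.trans_le h.length_le)]
  · rw [List.getElem?_eq_none (by rw [length_initSeg]; omega), List.getElem?_eq_none (by omega)]

theorem genericSet_freezePt (i : ℕ) : genericSet Z (freezePt i) = Z (freezePt i) := by
  have h := genericSeg_getElem? Z (i := i) (p := freezePt i) (by rw [length_genericSeg]; omega)
  rw [genericSeg_last] at h
  exact (Option.some.inj h).symm

theorem isGeneric_one_genericSet : IsGeneric 1 (genericSet Z) := by
  intro S hS
  obtain ⟨c, hc⟩ := exists_code_of_isSigma_one hS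
  obtain ⟨i, rfl⟩ : ∃ i, ofNat Code i = c := ⟨encode c, ofNat_encode c⟩
  -- Requirement `i` is settled in the gap after `freezePt i`: the appended suffix meets `S`, or no
  -- extension of the segment does.
  by_cases hex : ∃ ρ, genericSeg Z i ++ ρ ∈ S
  · obtain ⟨ρ, hρ⟩ := hex
    obtain ⟨k, hk⟩ := (hc _).1 hρ
    have h := (hc _).2 (acceptedSuffix_spec (length_genericSeg Z i) hk)
    exact ⟨_, Or.inl ((initSeg_eq_of_prefix Z (genericSeg_append_prefix Z i)).symm ▸ h)⟩
  · refine ⟨(genericSeg Z i).length, Or.inr fun τ hτ hτS => hex ?_⟩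
    rw [initSeg_eq_of_prefix Z (List.prefix_refl _)] at hτ
    obtain ⟨ρ, rfl⟩ := hτ
    exact ⟨ρ, hτS⟩

end Generic

end CompCat

/-! ### Gadget graphs and their definable parts -/

namespace CompCat

open Encodable Denumerable

/-- The vertices of the graphs to be constructed: a spine, two roots for every `n`, and two tags
for every pair `(n, s)`. -/
abbrev Vertex : Type := ℕ ⊕ (ℕ ⊕ ℕ) ⊕ ((ℕ × ℕ) ⊕ (ℕ × ℕ))

/-- The `n`-th vertex of the spine. -/
abbrev spine (n : ℕ) : Vertex := .inl n

/-- The root of `n` on side `b`. -/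
abbrev root (n : ℕ) (b : Bool) : Vertex := .inr (.inl (cond b (.inr n) (.inl n)))

/-- The first tag for `n` and stage `s`. -/
abbrev tag₀ (n s : ℕ) : Vertex := .inr (.inr (.inl (n, s)))

/-- The second tag for `n` and stage `s`. -/
abbrev tag₁ (n s : ℕ) : Vertex := .inr (.inr (.inr (n, s)))

section Graph

variable (e₀ e₁ fl : ℕ → ℕ → Bool)

/-- The out-neighbours of a vertex (possibly equal): a tag for `n` and `s` points to a root of `n`
if the event `e₀ n s` (for the first tag) or `e₁ n s` (for the second) happens, and is attached to
the spine otherwise; `fl` tells which of the two roots is used. -/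
def out : Vertex → Vertex × Vertex
  | .inl n => (spine (n + 1), spine (if n = 0 then 0 else n + 1))
  | .inr (.inl (.inl n)) => (spine (n + 1), spine (n + 2))
  | .inr (.inl (.inr n)) => (spine (n + 1), spine (n + 2))
  | .inr (.inr (.inl p)) =>
      cond (e₀ p.1 p.2) (root p.1 (fl p.1 p.2), root p.1 (fl p.1 p.2))
        (spine (2 * Nat.pair p.1 p.2 + 1), spine (2 * Nat.pair p.1 p.2 + 3))
  | .inr (.inr (.inr p)) =>
      cond (e₁ p.1 p.2) (root p.1 (!fl p.1 p.2), root p.1 (!fl p.1 p.2))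
        (spine (2 * Nat.pair p.1 p.2 + 1 + 1), spine (2 * Nat.pair p.1 p.2 + 1 + 3))

/-- The edge relation between vertices. -/
def Edge (x y : Vertex) : Prop := y = (out e₀ e₁ fl x).1 ∨ y = (out e₀ e₁ fl x).2

/-- The graph with edge relation `Edge`, moved to the domain `ℕ`. -/
def gadgetGraph : Digraph ℕ where
  Adj x y := Edge e₀ e₁ fl (ofNat Vertex x) (ofNat Vertex y)

/-- The graph on the natural numbers is isomorphic to the one on vertices. -/
def gadgetIso : (gadgetGraph e₀ e₁ fl).Adj ≃r Edge e₀ e₁ fl where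
  toEquiv := (Denumerable.eqv Vertex).symm
  map_rel_iff' := Iff.rfl

variable {e₀ e₁ fl}

theorem primrec_root : Primrec₂ root := by
  refine Primrec.sumInr.comp (Primrec.sumInl.comp (Primrec.cond Primrec.snd ?_ ?_))
  · exact Primrec.sumInr.comp Primrec.fst
  · exact Primrec.sumInl.comp Primrec.fst

theorem primrec_out (h₀ : Primrec₂ e₀) (h₁ : Primrec₂ e₁) (hfl : Primrec₂ fl) :
    Primrec (out e₀ e₁ fl) := by
  have hspine : Primrec spine := Primrec.sumInl
  have hadd : ∀ k : ℕ, Primrec fun n : ℕ => n + k := fun k =>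
    Primrec.nat_add.comp Primrec.id (Primrec.const k)
  have hpair : Primrec fun p : ℕ × ℕ => Nat.pair p.1 p.2 := Primrec₂.natPair
  have hdbl : Primrec fun p : ℕ × ℕ => 2 * Nat.pair p.1 p.2 := Primrec.nat_double.comp hpair
  have hs : Primrec fun n : ℕ => ((spine (n + 1), spine (if n = 0 then 0 else n + 1)) :
      Vertex × Vertex) :=
    Primrec.pair (hspine.comp (hadd 1)) (hspine.comp
      (Primrec.ite (Primrec.eq.comp Primrec.id (Primrec.const 0)) (Primrec.const 0) (hadd 1)))
  have hr : Primrec fun n : ℕ => ((spine (n + 1), spine (n + 2)) : Vertex × Vertex) :=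
    Primrec.pair (hspine.comp (hadd 1)) (hspine.comp (hadd 2))
  have hf : Primrec fun p : ℕ × ℕ => root p.1 (fl p.1 p.2) :=
    primrec_root.comp Primrec.fst hfl
  have hf' : Primrec fun p : ℕ × ℕ => root p.1 (!fl p.1 p.2) :=
    primrec_root.comp Primrec.fst (Primrec.not.comp hfl)
  have ht₀ : Primrec fun p : ℕ × ℕ =>
      cond (e₀ p.1 p.2) (root p.1 (fl p.1 p.2), root p.1 (fl p.1 p.2))
        (spine (2 * Nat.pair p.1 p.2 + 1), spine (2 * Nat.pair p.1 p.2 + 3)) :=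
    Primrec.cond h₀ (Primrec.pair hf hf) (Primrec.pair (hspine.comp ((hadd 1).comp hdbl))
      (hspine.comp ((hadd 3).comp hdbl)))
  have ht₁ : Primrec fun p : ℕ × ℕ =>
      cond (e₁ p.1 p.2) (root p.1 (!fl p.1 p.2), root p.1 (!fl p.1 p.2))
        (spine (2 * Nat.pair p.1 p.2 + 1 + 1), spine (2 * Nat.pair p.1 p.2 + 1 + 3)) :=
    Primrec.cond h₁ (Primrec.pair hf' hf') (Primrec.pair
      (hspine.comp ((hadd 1).comp ((hadd 1).comp hdbl)))
      (hspine.comp ((hadd 3).comp ((hadd 1).comp hdbl))))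
  refine (Primrec.sumCasesOn Primrec.id (hs.comp₂ Primrec₂.right) (Primrec.sumCasesOn Primrec.snd
    (Primrec.sumCasesOn Primrec.snd (hr.comp₂ Primrec₂.right) (hr.comp₂ Primrec₂.right)).to₂
    (Primrec.sumCasesOn Primrec.snd (ht₀.comp₂ Primrec₂.right)
      (ht₁.comp₂ Primrec₂.right)).to₂).to₂).of_eq fun x => ?_
  rcases x with n | (n | n) | (p | p) <;> rfl

theorem primrec_edge (h₀ : Primrec₂ e₀) (h₁ : Primrec₂ e₁) (hfl : Primrec₂ fl) :
    PrimrecRel (Edge e₀ e₁ fl) := by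
  have h := primrec_out h₀ h₁ hfl
  exact (Primrec.eq.comp Primrec.snd (Primrec.fst.comp (h.comp Primrec.fst))).or
    (Primrec.eq.comp Primrec.snd (Primrec.snd.comp (h.comp Primrec.fst)))

theorem isComputableGraph_gadgetGraph (h₀ : Primrec₂ e₀) (h₁ : Primrec₂ e₁)
    (hfl : Primrec₂ fl) : IsComputableGraph (gadgetGraph e₀ e₁ fl) :=
  PrimrecPred.computablePred <| (primrec_edge h₀ h₁ hfl).comp
    ((Primrec.ofNat Vertex).comp Primrec.fst) ((Primrec.ofNat Vertex).comp Primrec.snd)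

theorem edge_iff_of_out_eq {e₀' e₁' fl' : ℕ → ℕ → Bool} {g : Vertex → Vertex}
    (hg : Function.Injective g)
    (h : ∀ x, out e₀' e₁' fl' (g x) = (g (out e₀ e₁ fl x).1, g (out e₀ e₁ fl x).2))
    (x y : Vertex) : Edge e₀' e₁' fl' (g x) (g y) ↔ Edge e₀ e₁ fl x y := by
  simp only [Edge, h, hg.eq_iff]

theorem out_root (n : ℕ) (b : Bool) :
    out e₀ e₁ fl (root n b) = (spine (n + 1), spine (n + 2)) := by
  cases b <;> rfl

theorem out_tag₀_of_true {n s : ℕ} (h : e₀ n s = true) :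
    out e₀ e₁ fl (tag₀ n s) = (root n (fl n s), root n (fl n s)) := by
  simp [out, h]

theorem out_tag₁_of_true {n s : ℕ} (h : e₁ n s = true) :
    out e₀ e₁ fl (tag₁ n s) = (root n (!fl n s), root n (!fl n s)) := by
  simp [out, h]

theorem out_tag₀_of_false {n s : ℕ} (h : e₀ n s = false) : out e₀ e₁ fl (tag₀ n s) =
    (spine (2 * Nat.pair n s + 1), spine (2 * Nat.pair n s + 3)) := by
  simp [out, h]

theorem out_tag₁_of_false {n s : ℕ} (h : e₁ n s = false) : out e₀ e₁ fl (tag₁ n s) =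
    (spine (2 * Nat.pair n s + 1 + 1), spine (2 * Nat.pair n s + 1 + 3)) := by
  simp [out, h]

/-- The only loop pins down the start of the spine, from which rigidity propagates along the spine.
-/
theorem edge_self_iff {x : Vertex} : Edge e₀ e₁ fl x x ↔ x = spine 0 := by
  rcases x with n | (n | n) | (⟨n, s⟩ | ⟨n, s⟩)
  · rcases n with _ | n <;> simp [Edge, out]
  · simp [Edge, out]
  · simp [Edge, out]
  · cases h : e₀ n s <;> simp [Edge, out, h]
  · cases h : e₁ n s <;> simp [Edge, out, h]

theorem edge_spine_zero_iff {y : Vertex} :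
    Edge e₀ e₁ fl (spine 0) y ↔ y = spine 1 ∨ y = spine 0 := Iff.rfl

theorem edge_spine_succ_iff {n : ℕ} {y : Vertex} :
    Edge e₀ e₁ fl (spine (n + 1)) y ↔ y = spine (n + 2) := by
  simp [Edge, out]

/-- Only roots point to two consecutive spine vertices; tags attached to the spine use two vertices
at distance two. -/
theorem edge_root_iff {n : ℕ} {y : Vertex} :
    Edge e₀ e₁ fl y (spine (n + 1)) ∧ Edge e₀ e₁ fl y (spine (n + 2)) ↔
      ∃ b, y = root n b := by
  rcases y with m | (m | m) | (⟨m, s⟩ | ⟨m, s⟩)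
  · rcases m with _ | m <;> simp [Edge, out]
    omega
  · simp [Edge, out]; omega
  · simp [Edge, out]; omega
  · cases h : e₀ m s <;> simp [Edge, out, h]; omega
  · cases h : e₁ m s <;> simp [Edge, out, h]; omega

/-- The parity of `m` separates the two kinds of tag, and the pairing function recovers `n` and `s`;
an idle tag is therefore identified by its spine neighbours. -/
theorem edge_dummy_iff {m : ℕ} {y : Vertex} :
    Edge e₀ e₁ fl y (spine (m + 1)) ∧ Edge e₀ e₁ fl y (spine (m + 3)) ↔
      ∃ n s, (y = tag₀ n s ∧ e₀ n s = false ∧ m = 2 * Nat.pair n s) ∨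
        (y = tag₁ n s ∧ e₁ n s = false ∧ m = 2 * Nat.pair n s + 1) := by
  rcases y with k | (k | k) | (⟨k, s⟩ | ⟨k, s⟩)
  · rcases k with _ | k <;> simp [Edge, out]
    omega
  · simp [Edge, out]; omega
  · simp [Edge, out]; omega
  · cases h : e₀ k s
    · simp only [Edge, out, h, cond_false, Sum.inl.injEq, Sum.inr.injEq, Prod.mk.injEq, reduceCtorEq,
        false_and, or_false]
      constructor
      · exact fun _ => ⟨k, s, ⟨rfl, rfl⟩, h, by omega⟩
      · rintro ⟨_, _, ⟨rfl, rfl⟩, -, rfl⟩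
        omega
    · simp [Edge, out, h]
  · cases h : e₁ k s
    · simp only [Edge, out, h, cond_false, Sum.inl.injEq, Sum.inr.injEq, Prod.mk.injEq, reduceCtorEq,
        false_and, false_or]
      constructor
      · exact fun _ => ⟨k, s, ⟨rfl, rfl⟩, h, by omega⟩
      · rintro ⟨_, _, ⟨rfl, rfl⟩, -, rfl⟩
        omega
    · simp [Edge, out, h]

theorem edge_tag_iff {n : ℕ} {b : Bool} {y : Vertex} :
    Edge e₀ e₁ fl y (root n b) ↔
      ∃ s, (y = tag₀ n s ∧ e₀ n s = true ∧ b = fl n s) ∨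
        (y = tag₁ n s ∧ e₁ n s = true ∧ b = !fl n s) := by
  rcases y with k | (k | k) | (⟨k, s⟩ | ⟨k, s⟩)
  · simp [Edge, out]
  · simp [Edge, out]
  · simp [Edge, out]
  · cases h : e₀ k s <;> cases b <;> cases h' : fl k s <;> simp [Edge, out, h, h'] <;> grind
  · cases h : e₁ k s <;> cases b <;> cases h' : fl k s <;> simp [Edge, out, h, h'] <;> grind

theorem iso_spine {e₀' e₁' fl' : ℕ → ℕ → Bool} (f : Edge e₀ e₁ fl ≃r Edge e₀' e₁' fl') (n : ℕ) :
    f (spine n) = spine n := by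
  have h0 : f (spine 0) = spine 0 := by
    rw [← edge_self_iff (e₀ := e₀') (e₁ := e₁') (fl := fl'), f.map_rel_iff]
    exact edge_self_iff.2 rfl
  have h1 : f (spine 1) = spine 1 := by
    have h := f.map_rel_iff.2
      ((edge_spine_zero_iff (e₀ := e₀) (e₁ := e₁) (fl := fl)).2 (Or.inl rfl))
    rw [h0] at h
    refine h.resolve_right fun h' => ?_
    have h2 := f.injective (h'.trans h0.symm)
    simp at h2
  cases n with
  | zero => exact h0
  | succ n =>
    induction n with
    | zero => exact h1
    | succ n ih =>
      have h := f.map_rel_iff.2 ((edge_spine_succ_iff (e₀ := e₀) (e₁ := e₁) (fl := fl)).2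
        (rfl : spine (n + 2) = spine (n + 2)))
      rw [ih] at h
      exact edge_spine_succ_iff.1 h

/-- If only the first event happens for `n`, an isomorphism from the graph without flips to the
one with flips sends the root of `n` on the left side to the root determined by the flip. -/
theorem iso_root (f : Edge e₀ e₁ (fun _ _ => false) ≃r Edge e₀ e₁ fl) {n s : ℕ}
    (hs : e₀ n s = true) (huniq : ∀ s', e₀ n s' = true → s' = s) (hn : ∀ s, e₁ n s = false) :
    f (root n false) = root n (fl n s) := by
  obtain ⟨b, hb⟩ : ∃ b, f (root n false) = root n b := by
    rw [← edge_root_iff (e₀ := e₀) (e₁ := e₁) (fl := fl), ← iso_spine f (n + 1),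
      ← iso_spine f (n + 2), f.map_rel_iff, f.map_rel_iff]
    exact edge_root_iff.2 ⟨false, rfl⟩
  have h := f.map_rel_iff.2 ((edge_tag_iff (e₁ := e₁)).2 ⟨s, Or.inl ⟨rfl, hs, rfl⟩⟩)
  rw [hb] at h ⊢
  obtain ⟨s', ⟨-, hs', rfl⟩ | ⟨-, hs', -⟩⟩ := edge_tag_iff.1 h
  · rw [huniq s' hs']
  · simp [hn] at hs'

/-- Swap the two roots of `n` whenever `S n` holds. -/
def swapRoots (S : ℕ → Bool) : Vertex → Vertex
  | .inr (.inl (.inl n)) => root n (S n)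
  | .inr (.inl (.inr n)) => root n (!S n)
  | x => x

theorem swapRoots_root (S : ℕ → Bool) (n : ℕ) (b : Bool) :
    swapRoots S (root n b) = root n (b ^^ S n) := by
  cases b
  · rw [Bool.false_xor]; rfl
  · rw [Bool.true_xor]; rfl

theorem swapRoots_involutive (S : ℕ → Bool) : Function.Involutive (swapRoots S) := by
  rintro (n | (n | n) | (⟨n, s⟩ | ⟨n, s⟩))
  · rfl
  · exact (congrArg _ (swapRoots_root S n false)).trans
      ((swapRoots_root S n _).trans (by simp))
  · exact (congrArg _ (swapRoots_root S n true)).trans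
      ((swapRoots_root S n _).trans (by simp))
  · rfl
  · rfl

/-- The graph with flips is isomorphic to the one without. -/
theorem nonempty_iso_flip (h₀ : ∀ n s s', e₀ n s = true → e₀ n s' = true → s = s')
    (h₁ : ∀ n s, e₁ n s = true → ∃ s', e₀ n s' = true ∧ fl n s = fl n s') :
    Nonempty ((gadgetGraph e₀ e₁ fun _ _ => false).Adj ≃r (gadgetGraph e₀ e₁ fl).Adj) := by
  classical
  -- Swap exactly the root pairs whose first tag is flipped; since its stage is unique, `S` agrees
  -- with `fl` there.
  let S : ℕ → Bool := fun n => decide (∃ s, e₀ n s = true ∧ fl n s = true)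
  have hS : ∀ n s, e₀ n s = true → S n = fl n s := by
    intro n s hs
    rw [Bool.eq_iff_iff, decide_eq_true_iff]
    exact ⟨fun ⟨s', hs', hf⟩ => h₀ n s s' hs hs' ▸ hf, fun hf => ⟨s, hs, hf⟩⟩
  have hinv := swapRoots_involutive S
  have hout : ∀ x, out e₀ e₁ fl (swapRoots S x) =
      (swapRoots S (out e₀ e₁ (fun _ _ => false) x).1,
        swapRoots S (out e₀ e₁ (fun _ _ => false) x).2) := by
    rintro (n | (n | n) | (⟨n, s⟩ | ⟨n, s⟩))
    · rfl
    · exact out_root n (S n)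
    · exact out_root n (!S n)
    · change out e₀ e₁ fl (tag₀ n s) = _
      cases h : e₀ n s
      · rw [out_tag₀_of_false h, out_tag₀_of_false h]; rfl
      · rw [out_tag₀_of_true h, out_tag₀_of_true h, swapRoots_root, hS n s h, Bool.false_xor]
    · change out e₀ e₁ fl (tag₁ n s) = _
      cases h : e₁ n s
      · rw [out_tag₁_of_false h, out_tag₁_of_false h]; rfl
      · obtain ⟨s', hs', hf⟩ := h₁ n s h
        rw [out_tag₁_of_true h, out_tag₁_of_true h, swapRoots_root, hf, hS n s' hs',
          Bool.not_false, Bool.true_xor]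
  exact ⟨(gadgetIso _ _ _).trans (RelIso.trans ⟨hinv.toPerm, by
    intro x y; exact edge_iff_of_out_eq hinv.injective hout x y⟩ (gadgetIso _ _ _).symm)⟩

end Graph

end CompCat

/-! ### Searches computable in an oracle -/

namespace CompCat

open Encodable Denumerable

section Oracle

variable {α β γ δ : Type} [Primcodable α] [Primcodable β] [Primcodable γ] [Primcodable δ]
  {O : Set (ℕ →. ℕ)}

theorem computableIn_comp {f : β → γ} {g : α → β} (hf : ComputableIn O f)
    (hg : ComputableIn O g) : ComputableIn O fun a => f (g a) := by
  refine (Nat.RecursiveIn.comp hf hg).of_eq fun n => ?_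
  cases decode (α := α) n <;> simp

theorem computableIn_pair {f : α → β} {g : α → γ} (hf : ComputableIn O f)
    (hg : ComputableIn O g) : ComputableIn O fun a => (f a, g a) := by
  refine (Nat.RecursiveIn.pair hf hg).of_eq fun n => ?_
  cases decode (α := α) n <;> simp [Seq.seq]

theorem computableIn_comp₂ {f : β → γ → δ} {g : α → β} {h : α → γ}
    (hf : ComputableIn O fun p : β × γ => f p.1 p.2) (hg : ComputableIn O g)
    (hh : ComputableIn O h) : ComputableIn O fun a => f (g a) (h a) :=
  computableIn_comp hf (computableIn_pair hg hh)

theorem computableIn_nat_iff {f : ℕ → ℕ} :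
    ComputableIn O f ↔ Nat.RecursiveIn O fun n => Part.some (f n) := RecursiveIn.iff_nat

theorem recursiveIn_rfind {p : ℕ → ℕ → Bool} (hp : ComputableIn O fun q : ℕ × ℕ => p q.1 q.2) :
    Nat.RecursiveIn O fun n => Nat.rfind fun m => Part.some (p n m) := by
  -- `Nat.RecursiveIn.rfind` looks for a zero, so truth is coded by `0`.
  have h : ComputableIn O fun q : ℕ => cond (p q.unpair.1 q.unpair.2) 0 1 :=
    computableIn_comp (f := fun b : Bool => cond b 0 1)
      (Primrec.dom_bool _).computableIn
      (computableIn_comp hp ComputableIn.unpair)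
  refine (Nat.RecursiveIn.rfind (computableIn_nat_iff.1 h)).of_eq fun n => ?_
  congr 1
  funext m
  cases h : p n m <;> simp [h]

theorem exists_computableIn_search {p : ℕ → ℕ → Bool}
    (hp : ComputableIn O fun q : ℕ × ℕ => p q.1 q.2) (h : ∀ n, ∃ m, p n m = true) :
    ∃ f : ℕ → ℕ, ComputableIn O f ∧ ∀ n, p n (f n) = true := by
  refine ⟨fun n => Nat.find (h n), ?_, fun n => Nat.find_spec (h n)⟩
  refine computableIn_nat_iff.2 ((recursiveIn_rfind hp).of_eq_tot fun n => ?_)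
  refine Nat.mem_rfind.2 ⟨?_, fun {m} hm => ?_⟩
  · simpa using Nat.find_spec (h n)
  · simpa using Nat.find_min (h n) hm

theorem computableIn_of_search {p : ℕ → ℕ → Bool}
    (hp : ComputableIn O fun q : ℕ × ℕ => p q.1 q.2) {f : ℕ → ℕ}
    (h : ∀ n m, p n m = true ↔ m = f n) : ComputableIn O f := by
  obtain ⟨g, hg, hg'⟩ := exists_computableIn_search hp fun n => ⟨f n, (h _ _).2 rfl⟩
  have : f = g := funext fun n => ((h _ _).1 (hg' n)).symm
  exact this ▸ hg

/-- A sequence whose terms can be found from the preceding ones by search is computable. -/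
theorem computableIn_of_search_succ {p : ℕ → ℕ → Bool}
    (hp : ComputableIn O fun q : ℕ × ℕ => p q.1 q.2) {f : ℕ → ℕ}
    (h : ∀ n m, p (f n) m = true ↔ m = f (n + 1)) : ComputableIn O f := by
  have h1 : Nat.RecursiveIn O fun n : ℕ => Part.some n.unpair.2.unpair.2 :=
    computableIn_nat_iff.1 (Primrec.snd.comp (Primrec.unpair.comp
      (Primrec.snd.comp Primrec.unpair))).computableIn
  have h2 : Nat.RecursiveIn O fun n : ℕ => Part.some (Nat.pair 0 n) :=
    computableIn_nat_iff.1 (Primrec₂.natPair.comp (Primrec.const 0) Primrec.id).computableIn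
  -- The initial term is hard-wired; only the successor step is searched for.
  have h3 : Nat.RecursiveIn O fun _ : ℕ => Part.some (f 0) :=
    computableIn_nat_iff.1 (ComputableIn.const _)
  have h4 := Nat.RecursiveIn.comp (Nat.RecursiveIn.prec h3
    (Nat.RecursiveIn.comp (recursiveIn_rfind hp) h1)) h2
  refine computableIn_nat_iff.2 (h4.of_eq fun n => ?_)
  simp only [Part.bind_eq_bind, Part.bind_some, Nat.unpair_pair]
  induction n with
  | zero => rfl
  | succ n ih =>
    simp only [ih, Part.bind_some]
    refine Part.eq_some_iff.2 (Nat.mem_rfind.2 ⟨?_, fun {m} hm => ?_⟩)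
    · simpa using ((h n _).2 rfl).symm
    · have : p (f n) m ≠ true := fun h' => hm.ne ((h n m).1 h')
      simpa using this

theorem computableIn_oracle (X : ℕ → Bool) : ComputableIn (oracle X) X := by
  have h : ComputableIn (oracle X) fun n => (X n).toNat :=
    computableIn_nat_iff.2 (Nat.RecursiveIn.oracle _ rfl)
  have h' : ComputableIn (oracle X) fun n : ℕ => decide (n = 1) :=
    (PrimrecPred.decide (Primrec.eq.comp Primrec.id (Primrec.const 1))).computableIn
  have := computableIn_comp h' h
  have he : (fun n => decide ((X n).toNat = 1)) = X := by
    funext n; cases X n <;> rfl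
  rwa [he] at this

end Oracle

end CompCat

/-! ### Automorphisms that swap gadgets -/

namespace CompCat

open Encodable Denumerable

section Swap

variable {e₀ e₁ : ℕ → ℕ → Bool}

/-- The graph in which every tag points to the root on its own side. -/
abbrev StdEdge (e₀ e₁ : ℕ → ℕ → Bool) : Vertex → Vertex → Prop := Edge e₀ e₁ fun _ _ => false

/-- Swap the two roots of `n`, together with their tags, whenever `S n` holds. -/
def swapGadgets (e₀ e₁ : ℕ → ℕ → Bool) (S : ℕ → Bool) (s₀ s₁ : ℕ → ℕ) : Vertex → Vertex
  | .inl n => spine n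
  | .inr (.inl (.inl n)) => root n (S n)
  | .inr (.inl (.inr n)) => root n (!S n)
  | .inr (.inr (.inl p)) => cond (S p.1 && e₀ p.1 p.2) (tag₁ p.1 (s₁ p.1)) (tag₀ p.1 p.2)
  | .inr (.inr (.inr p)) => cond (S p.1 && e₁ p.1 p.2) (tag₀ p.1 (s₀ p.1)) (tag₁ p.1 p.2)

/-- Swapping gadgets is an automorphism if all swapped gadgets have either no tag or two tags. -/
theorem exists_swap_iso (S : ℕ → Bool)
    (h₀ : ∀ n s s', e₀ n s = true → e₀ n s' = true → s = s')
    (h₁ : ∀ n s s', e₁ n s = true → e₁ n s' = true → s = s')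
    (h₁₀ : ∀ n s, e₁ n s = true → ∃ s', e₀ n s' = true)
    (h₀₁ : ∀ n s, S n = true → e₀ n s = true → ∃ s', e₁ n s' = true) :
    ∃ α : StdEdge e₀ e₁ ≃r StdEdge e₀ e₁, (∀ n, α (spine n) = spine n) ∧
      ∀ n b, α (root n b) = root n (b ^^ S n) := by
  -- The stage of the event if it happens, otherwise the junk value `0`; the swap uses it only when
  -- the event on the other side happens, and then `h₁₀` excludes the junk case (`h₀₁` does so for
  -- `s₁`).
  have hs₀ : ∀ n, ∃ s, ∀ s', e₀ n s' = true → e₀ n s = true := fun n => by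
    by_cases h : ∃ s, e₀ n s = true
    · exact ⟨h.choose, fun _ _ => h.choose_spec⟩
    · exact ⟨0, fun s' hs' => (h ⟨s', hs'⟩).elim⟩
  have hs₁ : ∀ n, ∃ s, ∀ s', e₁ n s' = true → e₁ n s = true := fun n => by
    by_cases h : ∃ s, e₁ n s = true
    · exact ⟨h.choose, fun _ _ => h.choose_spec⟩
    · exact ⟨0, fun s' hs' => (h ⟨s', hs'⟩).elim⟩
  choose s₀ hs₀ using hs₀
  choose s₁ hs₁ using hs₁
  let g := swapGadgets e₀ e₁ S s₀ s₁
  have hroot : ∀ n b, g (root n b) = root n (b ^^ S n) := by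
    intro n b
    cases b
    · rw [Bool.false_xor]; rfl
    · rw [Bool.true_xor]; rfl
  have htag₀ : ∀ n s, g (tag₀ n s) = cond (S n && e₀ n s) (tag₁ n (s₁ n)) (tag₀ n s) :=
    fun _ _ => rfl
  have htag₁ : ∀ n s, g (tag₁ n s) = cond (S n && e₁ n s) (tag₀ n (s₀ n)) (tag₁ n s) :=
    fun _ _ => rfl
  have hinv : Function.Involutive g := by
    rintro (n | (n | n) | (⟨n, s⟩ | ⟨n, s⟩))
    · rfl
    · exact (congrArg g (hroot n false)).trans ((hroot n _).trans (by simp))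
    · exact (congrArg g (hroot n true)).trans ((hroot n _).trans (by simp))
    · change g (g (tag₀ n s)) = tag₀ n s
      cases hS : S n && e₀ n s
      · simp [htag₀, hS]
      · have hS' := hS
        rw [Bool.and_eq_true] at hS'
        obtain ⟨s', hs'⟩ := h₀₁ n s hS'.1 hS'.2
        rw [htag₀, hS, cond_true, htag₁, hS'.1, hs₁ n s' hs', Bool.and_self, cond_true,
          h₀ n _ _ (hs₀ n s hS'.2) hS'.2]
    · change g (g (tag₁ n s)) = tag₁ n s
      cases hS : S n && e₁ n s
      · simp [htag₁, hS]
      · have hS' := hS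
        rw [Bool.and_eq_true] at hS'
        obtain ⟨s', hs'⟩ := h₁₀ n s hS'.2
        rw [htag₁, hS, cond_true, htag₀, hS'.1, hs₀ n s' hs', Bool.and_self, cond_true,
          h₁ n _ _ (hs₁ n s hS'.2) hS'.2]
  have hout : ∀ x, out e₀ e₁ (fun _ _ => false) (g x) =
      (g (out e₀ e₁ (fun _ _ => false) x).1, g (out e₀ e₁ (fun _ _ => false) x).2) := by
    rintro (n | (n | n) | (⟨n, s⟩ | ⟨n, s⟩))
    · rfl
    · exact out_root n (S n)
    · exact out_root n (!S n)
    · change out _ _ _ (g (tag₀ n s)) = (g (out _ _ _ (tag₀ n s)).1, g (out _ _ _ (tag₀ n s)).2)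
      rw [htag₀]
      cases he : e₀ n s
      · rw [Bool.and_false, cond_false, out_tag₀_of_false he]; rfl
      · rw [out_tag₀_of_true he, hroot, Bool.false_xor, Bool.and_true]
        cases hS : S n
        · rw [cond_false, out_tag₀_of_true he]
        · obtain ⟨s', hs'⟩ := h₀₁ n s hS he
          rw [cond_true, out_tag₁_of_true (hs₁ n s' hs'), Bool.not_false]
    · change out _ _ _ (g (tag₁ n s)) = (g (out _ _ _ (tag₁ n s)).1, g (out _ _ _ (tag₁ n s)).2)
      rw [htag₁]
      cases he : e₁ n s
      · rw [Bool.and_false, cond_false, out_tag₁_of_false he]; rfl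
      · rw [out_tag₁_of_true he, hroot, Bool.not_false, Bool.true_xor, Bool.and_true]
        cases hS : S n
        · rw [cond_false, out_tag₁_of_true he]
        · obtain ⟨s', hs'⟩ := h₁₀ n s he
          rw [cond_true, out_tag₀_of_true (hs₀ n s' hs'), Bool.not_true]
  exact ⟨⟨hinv.toPerm, by intro x y; exact edge_iff_of_out_eq hinv.injective hout x y⟩,
    fun _ => rfl, hroot⟩

theorem root_injective (n : ℕ) : Function.Injective (root n) := by
  intro a b h
  cases a <;> cases b <;> simp at h ⊢

/-- Whether a vertex is a tag. -/
def isTag : Vertex → Bool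
  | .inr (.inr _) => true
  | _ => false

/-- An active tag is the only one on its root because its event has a unique stage; an idle tag is
determined by its two spine neighbours. Hence the image of a tag can be found by search once the
images of its out-neighbours are known. -/
theorem eq_of_edge_out (h₀ : ∀ n s s', e₀ n s = true → e₀ n s' = true → s = s')
    (h₁ : ∀ n s s', e₁ n s = true → e₁ n s' = true → s = s') {x y : Vertex}
    (hx : isTag x = true)
    (hy₁ : StdEdge e₀ e₁ y (out e₀ e₁ (fun _ _ => false) x).1)
    (hy₂ : StdEdge e₀ e₁ y (out e₀ e₁ (fun _ _ => false) x).2) : y = x := by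
  rcases x with n | (n | n) | (⟨n, s⟩ | ⟨n, s⟩)
  · simp [isTag] at hx
  · simp [isTag] at hx
  · simp [isTag] at hx
  · change StdEdge e₀ e₁ y (out e₀ e₁ (fun _ _ => false) (tag₀ n s)).1 at hy₁
    change StdEdge e₀ e₁ y (out e₀ e₁ (fun _ _ => false) (tag₀ n s)).2 at hy₂
    change y = tag₀ n s
    cases he : e₀ n s
    · rw [out_tag₀_of_false he] at hy₁ hy₂
      obtain ⟨n', s', ⟨rfl, -, h⟩ | ⟨-, -, h⟩⟩ := edge_dummy_iff.1 ⟨hy₁, hy₂⟩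
      · obtain ⟨rfl, rfl⟩ := Nat.pair_eq_pair.1 (by omega : Nat.pair n s = Nat.pair n' s')
        rfl
      · omega
    · rw [out_tag₀_of_true he] at hy₁
      obtain ⟨s', ⟨rfl, hs', -⟩ | ⟨-, -, h⟩⟩ := edge_tag_iff.1 hy₁
      · rw [h₀ n _ _ hs' he]
      · simp at h
  · change StdEdge e₀ e₁ y (out e₀ e₁ (fun _ _ => false) (tag₁ n s)).1 at hy₁
    change StdEdge e₀ e₁ y (out e₀ e₁ (fun _ _ => false) (tag₁ n s)).2 at hy₂
    change y = tag₁ n s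
    cases he : e₁ n s
    · rw [out_tag₁_of_false he] at hy₁ hy₂
      obtain ⟨n', s', ⟨-, -, h⟩ | ⟨rfl, -, h⟩⟩ := edge_dummy_iff.1 ⟨hy₁, hy₂⟩
      · omega
      · obtain ⟨rfl, rfl⟩ := Nat.pair_eq_pair.1 (by omega : Nat.pair n s = Nat.pair n' s')
        rfl
    · rw [out_tag₁_of_true he] at hy₁
      obtain ⟨s', ⟨-, -, h⟩ | ⟨rfl, hs', -⟩⟩ := edge_tag_iff.1 hy₁
      · simp at h
      · rw [h₁ n _ _ hs' he]

end Swap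

/-! ### Computing isomorphisms from an oracle -/

section Relative

variable {e₀ e₁ : ℕ → ℕ → Bool} {O : Set (ℕ →. ℕ)}

/-- The parameter of a vertex: the index of a root, or one less than the index in the spine. -/
def vertexIndex : Vertex → ℕ
  | .inl n => n - 1
  | .inr (.inl (.inl n)) => n
  | .inr (.inl (.inr n)) => n
  | .inr (.inr _) => 0

/-- Select `q`, `a`, `b` or `c` according to whether the vertex is the first one of the spine or a
tag, another vertex of the spine, or a root on the left or right side. -/
def vertexSelect (q a b c : ℕ) : Vertex → ℕ
  | .inl n => if n = 0 then q else a
  | .inr (.inl (.inl _)) => b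
  | .inr (.inl (.inr _)) => c
  | .inr (.inr _) => q

theorem primrec_vertexIndex : Primrec vertexIndex := by
  refine (Primrec.sumCasesOn Primrec.id (Primrec.pred.comp₂ Primrec₂.right)
    (Primrec.sumCasesOn Primrec.snd
    (Primrec.sumCasesOn Primrec.snd Primrec₂.right Primrec₂.right).to₂
    (Primrec₂.const 0)).to₂).of_eq fun x => ?_
  rcases x with n | (n | n) | p <;> rfl

theorem primrec_vertexSelect (q : ℕ) :
    Primrec fun z : Vertex × ℕ × ℕ × ℕ => vertexSelect q z.2.1 z.2.2.1 z.2.2.2 z.1 := by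
  have h1 : Primrec₂ fun (z : Vertex × ℕ × ℕ × ℕ) (n : ℕ) => if n = 0 then q else z.2.1 :=
    Primrec.ite (Primrec.eq.comp Primrec.snd (Primrec.const 0)) (Primrec.const q)
      (Primrec.fst.comp (Primrec.snd.comp Primrec.fst))
  have h2 : Primrec fun z : ((Vertex × ℕ × ℕ × ℕ) × ((ℕ ⊕ ℕ) ⊕ (ℕ × ℕ) ⊕ (ℕ × ℕ))) × (ℕ ⊕ ℕ) =>
      z.1.1.2.2.1 := Primrec.fst.comp (Primrec.snd.comp (Primrec.snd.comp
        (Primrec.fst.comp Primrec.fst)))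
  have h3 : Primrec fun z : ((Vertex × ℕ × ℕ × ℕ) × ((ℕ ⊕ ℕ) ⊕ (ℕ × ℕ) ⊕ (ℕ × ℕ))) × (ℕ ⊕ ℕ) =>
      z.1.1.2.2.2 := Primrec.snd.comp (Primrec.snd.comp (Primrec.snd.comp
        (Primrec.fst.comp Primrec.fst)))
  refine (Primrec.sumCasesOn Primrec.fst h1
    (Primrec.sumCasesOn Primrec.snd
    (Primrec.sumCasesOn Primrec.snd (h2.comp Primrec.fst).to₂ (h3.comp Primrec.fst).to₂).to₂
    (Primrec₂.const q)).to₂).of_eq fun z => ?_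
  obtain ⟨n | (n | n) | p, z⟩ := z <;> rfl

theorem primrec_isTag : Primrec isTag := by
  refine (Primrec.sumCasesOn Primrec.id (Primrec₂.const false)
    (Primrec.sumCasesOn Primrec.snd (Primrec₂.const false) (Primrec₂.const true)).to₂).of_eq
      fun x => ?_
  rcases x with n | n | p <;> rfl

/-- If the oracle computes for every `n` whether to look for a tagged root, and whenever it does
not, the two roots of `n` are automorphic, then it computes isomorphisms to all copies of the graph
whose edge relation it computes. -/
theorem exists_computableIn_iso (he₀ : Primrec₂ e₀) (he₁ : Primrec₂ e₁)
    (h₀ : ∀ n s s', e₀ n s = true → e₀ n s' = true → s = s')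
    (h₁ : ∀ n s s', e₁ n s = true → e₁ n s' = true → s = s')
    (h₁₀ : ∀ n s, e₁ n s = true → ∃ s', e₀ n s' = true)
    {G : ℕ → Bool} (hG : ComputableIn O G)
    (hG₀ : ∀ n s, G n = false → e₀ n s = true → ∃ s', e₁ n s' = true)
    (hG₁ : ∀ n, G n = true → ∃ s, e₀ n s = true)
    {r : ℕ → ℕ → Bool} (hr : ComputableIn O fun p : ℕ × ℕ => r p.1 p.2)
    (Φ : StdEdge e₀ e₁ ≃r fun x y => r x y = true) :
    ∃ f : StdEdge e₀ e₁ ≃r fun x y => r x y = true,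
      ComputableIn O fun x : ℕ => f (ofNat Vertex x) := by
  have hΦ : ∀ x y, r (Φ x) (Φ y) = true ↔ StdEdge e₀ e₁ x y := fun x y => Φ.map_rel_iff
  have hsurj : ∀ y, ∃ x, Φ x = y := Φ.surjective
  have hfst : ComputableIn O fun q : ℕ × ℕ => q.1 := ComputableIn.fst
  have hsnd : ComputableIn O fun q : ℕ × ℕ => q.2 := ComputableIn.snd
  have hsucc : ComputableIn O fun n : ℕ => n + 1 := ComputableIn.succ
  have hand : ComputableIn O fun q : Bool × Bool => q.1 && q.2 := Primrec.and.computableIn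
  have hbeq : ComputableIn O fun q : ℕ × ℕ => decide (q.1 = q.2) :=
    (PrimrecPred.decide Primrec.eq).computableIn
  -- the spine
  have hD : ComputableIn O fun n => Φ (spine (n + 1)) := by
    refine computableIn_of_search_succ (p := r) hr fun n m => ?_
    obtain ⟨x, rfl⟩ := hsurj m
    exact (hΦ _ _).trans (edge_spine_succ_iff.trans Φ.injective.eq_iff.symm)
  let isRoot : ℕ → ℕ → Bool := fun n y => r y (Φ (spine (n + 1))) && r y (Φ (spine (n + 2)))
  have hRoot : ∀ n y, isRoot n y = true ↔ ∃ b, y = Φ (root n b) := by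
    intro n y
    obtain ⟨x, rfl⟩ := hsurj y
    simp only [isRoot, Bool.and_eq_true, hΦ, Φ.injective.eq_iff]
    exact edge_root_iff
  have hisRoot : ComputableIn O fun q : ℕ × ℕ => isRoot q.1 q.2 :=
    computableIn_comp₂ (f := fun a b => a && b) hand
      (computableIn_comp₂ hr hsnd (computableIn_comp (f := fun n => Φ (spine (n + 1))) hD hfst))
      (computableIn_comp₂ hr hsnd (computableIn_comp (f := fun n => Φ (spine (n + 2)))
        (computableIn_comp (f := fun n => Φ (spine (n + 1))) hD hsucc) hfst))
  -- the left roots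
  obtain ⟨ra, hra, hra'⟩ : ∃ ra : ℕ → ℕ, ComputableIn O ra ∧ ∀ n, isRoot n (ra n) = true ∧
      (G n = true → ∃ w, r w (ra n) = true) := by
    -- `z` pairs a candidate root with a vertex pointing to it; the second part is required only
    -- when `G n` promises a tag.
    let p : ℕ → ℕ → Bool := fun n z =>
      isRoot n z.unpair.1 && (!G n || r z.unpair.2 z.unpair.1)
    have hu₁ : ComputableIn O fun q : ℕ × ℕ => q.2.unpair.1 :=
      (Primrec.fst.comp (Primrec.unpair.comp Primrec.snd)).computableIn
    have hu₂ : ComputableIn O fun q : ℕ × ℕ => q.2.unpair.2 :=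
      (Primrec.snd.comp (Primrec.unpair.comp Primrec.snd)).computableIn
    have hor : ComputableIn O fun q : Bool × Bool => !q.1 || q.2 :=
      (Primrec.dom_bool₂ fun a b => !a || b).computableIn
    have hp : ComputableIn O fun q : ℕ × ℕ => p q.1 q.2 :=
      computableIn_comp₂ (f := fun a b => a && b) hand (computableIn_comp₂ hisRoot hfst hu₁)
        (computableIn_comp₂ (f := fun a b => !a || b) hor (computableIn_comp hG hfst)
          (computableIn_comp₂ hr hu₂ hu₁))
    obtain ⟨f, hf, hf'⟩ := exists_computableIn_search hp fun n => by
      cases h : G n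
      · exact ⟨Nat.pair (Φ (root n false)) 0, by simp [p, h, hRoot]⟩
      · obtain ⟨s, hs⟩ := hG₁ n h
        refine ⟨Nat.pair (Φ (root n false)) (Φ (tag₀ n s)), ?_⟩
        have hE : StdEdge e₀ e₁ (tag₀ n s) (root n false) :=
          edge_tag_iff.2 ⟨s, Or.inl ⟨rfl, hs, rfl⟩⟩
        simp only [p, Nat.unpair_pair, (hRoot n _).2 ⟨false, rfl⟩, (hΦ _ _).2 hE, Bool.or_true,
          Bool.and_self]
    refine ⟨fun n => (f n).unpair.1, computableIn_comp
      (f := fun z : ℕ => z.unpair.1) (Primrec.fst.comp Primrec.unpair).computableIn hf,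
      fun n => ?_⟩
    have h := hf' n
    simp only [p, Bool.and_eq_true, Bool.or_eq_true, Bool.not_eq_true'] at h
    refine ⟨h.1, fun hGn => ⟨_, h.2.resolve_left ?_⟩⟩
    simp [hGn]
  -- `S n` records whether the root found is the `Φ`-image of the right one; it need not be
  -- computable, as it serves only to correct `Φ` by an automorphism.
  choose S hraS using fun n => (hRoot n _).1 (hra' n).1
  obtain ⟨α, hαs, hαr⟩ := exists_swap_iso S h₀ h₁ h₁₀ (fun n s hSn hs => by
    cases h : G n
    · exact hG₀ n s h hs
    -- The search found the right root together with a vertex pointing to it, which must be a second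
    -- tag; so both roots are tagged.
    · obtain ⟨w, hw⟩ := (hra' n).2 h
      obtain ⟨x, rfl⟩ := hsurj w
      rw [hraS, hSn, hΦ] at hw
      obtain ⟨s', ⟨-, -, h'⟩ | ⟨-, hs', -⟩⟩ := edge_tag_iff.1 hw
      · simp at h'
      · exact ⟨s', hs'⟩)
  -- the right roots
  have hrb : ComputableIn O fun n => Φ (root n (!S n)) := by
    have hne : ComputableIn O fun q : ℕ × ℕ => !decide (q.1 = q.2) :=
      (Primrec.not.comp (PrimrecPred.decide Primrec.eq)).computableIn
    refine computableIn_of_search (p := fun n y => isRoot n y && !decide (y = ra n))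
      (computableIn_comp₂ (f := fun a b => a && b) hand hisRoot
        (computableIn_comp₂ (f := fun a b => !decide (a = b)) hne hsnd
          (computableIn_comp hra hfst))) fun n m => ?_
    rw [Bool.and_eq_true, hRoot, Bool.not_eq_true', decide_eq_false_iff_not, hraS]
    constructor
    · rintro ⟨⟨b, rfl⟩, h⟩
      have hb : b ≠ S n := fun hb => h (by rw [hb])
      rw [Bool.eq_not.2 hb]
    · rintro rfl
      exact ⟨⟨_, rfl⟩, fun h => Bool.not_ne_self _ (root_injective n (Φ.injective h))⟩
  -- images of all vertices other than tags
  let val : Vertex → ℕ := fun x => vertexSelect (Φ (spine 0)) (Φ (spine (vertexIndex x + 1)))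
    (ra (vertexIndex x)) (Φ (root (vertexIndex x) (!S (vertexIndex x)))) x
  have hval : ComputableIn O val := by
    have hi : ComputableIn O vertexIndex := primrec_vertexIndex.computableIn
    have hid : ComputableIn O fun x : Vertex => x := ComputableIn.id
    exact computableIn_comp (primrec_vertexSelect (Φ (spine 0))).computableIn
      (computableIn_pair hid (computableIn_pair
        (computableIn_comp (f := fun n => Φ (spine (n + 1))) hD hi)
        (computableIn_pair (computableIn_comp hra hi)
          (computableIn_comp (f := fun n => Φ (root n (!S n))) hrb hi))))
  have hval' : ∀ x, isTag x = false → val x = Φ (α x) := by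
    rintro (n | (n | n) | p) hx
    · rcases n with _ | n
      · exact congrArg Φ (hαs 0).symm
      · exact congrArg Φ (hαs (n + 1)).symm
    · refine (hraS n).trans (congrArg Φ ?_)
      rw [← Bool.false_xor (S n)]
      exact (hαr n false).symm
    · exact congrArg Φ ((congrArg (root n) (Bool.true_xor (S n)).symm).trans (hαr n true).symm)
    · simp [isTag] at hx
  have hout : ∀ x, isTag (out e₀ e₁ (fun _ _ => false) x).1 = false ∧
      isTag (out e₀ e₁ (fun _ _ => false) x).2 = false := by
    rintro (n | (n | n) | (⟨n, s⟩ | ⟨n, s⟩))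
    · exact ⟨rfl, rfl⟩
    · exact ⟨rfl, rfl⟩
    · exact ⟨rfl, rfl⟩
    · cases h : e₀ n s <;> simp [out, h, isTag]
    · cases h : e₁ n s <;> simp [out, h, isTag]
  let o : Vertex → Vertex × Vertex := out e₀ e₁ fun _ _ => false
  have ho : Primrec o := primrec_out he₀ he₁ (Primrec₂.const false)
  -- No out-neighbour of a tag is a tag, so `val` gives the correct images of both and the tag's own
  -- image is recognized by its edges to them.
  let test : ℕ → ℕ → Bool := fun x w => cond (isTag (ofNat Vertex x))
    (r w (val (o (ofNat Vertex x)).1) && r w (val (o (ofNat Vertex x)).2))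
    (decide (w = val (ofNat Vertex x)))
  have htest : ComputableIn O fun q : ℕ × ℕ => test q.1 q.2 := by
    have hx : Primrec fun q : ℕ × ℕ => ofNat Vertex q.1 :=
      (Primrec.ofNat Vertex).comp Primrec.fst
    have hcond : ComputableIn O fun q : Bool × Bool × Bool => cond q.1 q.2.1 q.2.2 :=
      (Primrec.cond Primrec.fst (Primrec.fst.comp Primrec.snd)
        (Primrec.snd.comp Primrec.snd)).computableIn
    exact computableIn_comp hcond (computableIn_pair (primrec_isTag.comp hx).computableIn
      (computableIn_pair (computableIn_comp₂ (f := fun a b => a && b) hand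
        (computableIn_comp₂ hr hsnd
          (computableIn_comp hval (Primrec.fst.comp (ho.comp hx)).computableIn))
        (computableIn_comp₂ hr hsnd
          (computableIn_comp hval (Primrec.snd.comp (ho.comp hx)).computableIn)))
        (computableIn_comp₂ (f := fun a b => decide (a = b)) hbeq hsnd
          (computableIn_comp hval hx.computableIn))))
  refine ⟨α.trans Φ, computableIn_of_search htest fun x w => ?_⟩
  change _ ↔ w = Φ (α (ofNat Vertex x))
  cases hx : isTag (ofNat Vertex x)
  · simp only [test, hx, cond_false, decide_eq_true_eq, hval' _ hx]
  · obtain ⟨y, rfl⟩ := hsurj w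
    obtain ⟨y, rfl⟩ := α.surjective y
    simp only [test, hx, cond_true, Bool.and_eq_true, hval' _ (hout _).1, hval' _ (hout _).2, o,
      hΦ, Φ.injective.eq_iff, α.injective.eq_iff]
    rw [α.map_rel_iff, α.map_rel_iff]
    constructor
    · exact fun h => eq_of_edge_out h₀ h₁ hx h.1 h.2
    · intro h
      rw [h]
      exact ⟨Or.inl rfl, Or.inr rfl⟩

end Relative

end CompCat

/-! ### The diagonalizing pair of graphs -/

namespace CompCat

open Nat.Partrec (Code)
open Encodable Denumerable

section First

/-- `s` is the first stage at which `p n` holds. -/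
def firstStage (p : ℕ → ℕ → Bool) (n s : ℕ) : Bool :=
  p n s && decide (∀ s' < s, p n s' = false)

variable {p : ℕ → ℕ → Bool}

theorem firstStage_iff {n s : ℕ} :
    firstStage p n s = true ↔ p n s = true ∧ ∀ s' < s, p n s' = false := by
  simp [firstStage]

theorem firstStage_unique {n s s' : ℕ} (h : firstStage p n s = true)
    (h' : firstStage p n s' = true) : s = s' := by
  rw [firstStage_iff] at h h'
  rcases lt_trichotomy s s' with hlt | rfl | hlt
  · simpa [h.1] using h'.2 s hlt
  · rfl
  · simpa [h'.1] using h.2 s' hlt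

theorem exists_firstStage_le {n s : ℕ} (h : p n s = true) :
    ∃ s' ≤ s, firstStage p n s' = true := by
  have hex : ∃ s, p n s = true := ⟨s, h⟩
  exact ⟨Nat.find hex, Nat.find_min' hex h, firstStage_iff.2 ⟨Nat.find_spec hex, fun s' hs' =>
    Bool.eq_false_iff.2 (Nat.find_min hex hs')⟩⟩

theorem primrec_firstStage (hp : Primrec₂ p) : Primrec₂ (firstStage p) := by
  have hR : PrimrecRel fun s n : ℕ => p n s = false :=
    Primrec.eq.comp (hp.comp Primrec.snd Primrec.fst) (Primrec.const false)
  exact Primrec.and.comp hp (PrimrecPred.decide (hR.forall_lt.comp Primrec.snd Primrec.fst))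

end First

/-- The number of the left root of `n`. -/
def rootCode (n : ℕ) : ℕ := encode (root n false)

/-- The value, computed in `s` steps, of the program opposed by `n` at the left root of `n`. -/
def opponentValue (n s : ℕ) : Option ℕ := Code.evaln s (ofNat Code n.unpair.1) (rootCode n)

/-- The program opposed by `n` has halted at the left root of `n` in `s` steps, or `n` has been
released at stage `s`. -/
def activated (n s : ℕ) : Bool := (opponentValue n s).isSome || released n s

/-- The program opposed by `n` has been seen to fix the left root of `n`. -/
def flipped (n s : ℕ) : Bool := decide (opponentValue n s = some (rootCode n))

theorem primrec_rootCode : Primrec rootCode :=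
  Primrec.encode.comp (primrec_root.comp Primrec.id (Primrec.const false))

theorem primrec_opponentValue : Primrec₂ opponentValue :=
  Code.primrec_evaln.comp (Primrec.pair (Primrec.pair Primrec.snd ((Primrec.ofNat Code).comp
    (Primrec.fst.comp (Primrec.unpair.comp Primrec.fst)))) (primrec_rootCode.comp Primrec.fst))

theorem primrec_activated : Primrec₂ activated :=
  Primrec.or.comp (Primrec.option_isSome.comp primrec_opponentValue) primrec_released

theorem primrec_flipped : Primrec₂ flipped :=
  PrimrecPred.decide (Primrec.eq.comp primrec_opponentValue
    (Primrec.option_some.comp (primrec_rootCode.comp Primrec.fst)))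

theorem opponentValue_mono {n s s' v : ℕ} (hs : s ≤ s') (h : opponentValue n s = some v) :
    opponentValue n s' = some v := Code.evaln_mono hs h

/-- The graph without flips. -/
def stdGraph : Digraph ℕ :=
  gadgetGraph (firstStage activated) (firstStage released) fun _ _ => false

/-- The copy of the graph that diagonalizes against computable isomorphisms. -/
def flipGraph : Digraph ℕ := gadgetGraph (firstStage activated) (firstStage released) flipped

theorem isComputableGraph_stdGraph : IsComputableGraph stdGraph :=
  isComputableGraph_gadgetGraph (primrec_firstStage primrec_activated)
    (primrec_firstStage primrec_released) (Primrec₂.const false)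

theorem isComputableGraph_flipGraph : IsComputableGraph flipGraph :=
  isComputableGraph_gadgetGraph (primrec_firstStage primrec_activated)
    (primrec_firstStage primrec_released) primrec_flipped

/-- If activation precedes release, it was caused by a halting computation, whose value persists.
The flip decision is thus the same at both stages, and in the flipped copy the two tags of `n` land
on different roots. -/
theorem exists_activated_of_released {n s : ℕ} (h : firstStage released n s = true) :
    ∃ s', firstStage activated n s' = true ∧ flipped n s = flipped n s' := by
  have h' := firstStage_iff.1 h
  obtain ⟨s', hle, hs'⟩ := exists_firstStage_le (p := activated) (n := n) (s := s)
    (by simp [activated, h'.1])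
  refine ⟨s', hs', ?_⟩
  rcases hle.eq_or_lt with rfl | hlt
  · rfl
  · have hv := (firstStage_iff.1 hs').1
    rw [activated, h'.2 s' hlt, Bool.or_false, Option.isSome_iff_exists] at hv
    obtain ⟨v, hv⟩ := hv
    rw [flipped, flipped, hv, opponentValue_mono hle hv]

theorem not_isComputablyCategorical_stdGraph : ¬ IsComputablyCategorical stdGraph := by
  intro hcat
  obtain ⟨f, hf⟩ := hcat flipGraph isComputableGraph_flipGraph
    (nonempty_iso_flip (fun _ _ _ => firstStage_unique) fun _ _ => exists_activated_of_released)
  obtain ⟨c, hc⟩ := Code.exists_code.1 (Partrec.nat_iff.1 hf.partrec)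
  obtain ⟨i, rfl⟩ : ∃ i, ofNat Code i = c := ⟨encode c, ofNat_encode c⟩
  set n := freezePt i with hn
  have hval : f (rootCode n) ∈ Code.eval (ofNat Code n.unpair.1) (rootCode n) := by
    rw [hn, unpair_freezePt, hc]
    exact Part.mem_some _
  obtain ⟨k, hk⟩ := Code.evaln_complete.1 hval
  obtain ⟨s, -, hs⟩ := exists_firstStage_le (p := activated) (n := n) (s := k)
    (by rw [activated, opponentValue, Option.mem_def.1 hk]; rfl)
  have hrel : ∀ s, released n s = false := fun s =>
    Bool.eq_false_iff.2 fun h => not_released_freezePt i ⟨s, h⟩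
  have hs' : opponentValue n s = some (f (rootCode n)) := by
    have h := (firstStage_iff.1 hs).1
    rw [activated, hrel, Bool.or_false, Option.isSome_iff_exists] at h
    obtain ⟨v, hv⟩ := h
    rw [hv, Part.mem_unique (Code.evaln_sound hv) hval]
  -- A frozen `n` never gets a second tag, so the isomorphism must follow the only one.
  have h := iso_root ((gadgetIso _ _ _).symm.trans (RelIso.trans f (gadgetIso _ _ _))) hs
    (fun s' h' => firstStage_unique h' hs) fun s => by simp [firstStage, hrel]
  have h' : f (rootCode n) = encode (root n (flipped n s)) := by
    rw [← h]
    exact (encode_ofNat (α := Vertex) _).symm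
  -- Without a flip `f` fixes the left root, which is exactly what triggers a flip; with a flip `f`
  -- sends it to the right root, although the flip required it to be fixed.
  cases hfl : flipped n s
  · rw [hfl] at h'
    have : flipped n s = true := by
      rw [flipped, hs', h']
      exact decide_eq_true rfl
    simp [hfl] at this
  · rw [hfl] at h'
    have h2 : opponentValue n s = some (rootCode n) := of_decide_eq_true hfl
    rw [hs', Option.some_inj, h'] at h2
    simpa using root_injective n (encode_injective h2)

/-! ### The generic set and its properties -/

open Classical in
/-- The positions whose opposed program halts. -/
noncomputable def haltingSet (n : ℕ) : Bool := decide (∃ s, (opponentValue n s).isSome = true)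

/-- The generic set. -/
noncomputable def theGeneric : ℕ → Bool := genericSet haltingSet

theorem theGeneric_iff {n : ℕ} (h : ¬ ∃ s, released n s = true) :
    theGeneric n = true ↔ ∃ s, (opponentValue n s).isSome = true := by
  have h' : theGeneric n = haltingSet n := by
    rw [(not_released_iff n).1 h]
    exact genericSet_freezePt _ _
  simp [h', haltingSet]

/-- At a frozen `n` the bit `false` means the opponent never halts, so there is no activation at
all; only released `n` remain. -/
theorem exists_released_of_theGeneric_eq_false {n s : ℕ} (hG : theGeneric n = false)
    (hs : firstStage activated n s = true) : ∃ s', firstStage released n s' = true := by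
  by_cases h : ∃ s, released n s = true
  · obtain ⟨s', hs'⟩ := h
    obtain ⟨t, -, ht⟩ := exists_firstStage_le hs'
    exact ⟨t, ht⟩
  · have h1 := (firstStage_iff.1 hs).1
    rw [activated, Bool.or_eq_true] at h1
    rcases h1 with h1 | h1
    · have := (theGeneric_iff h).2 ⟨s, h1⟩
      simp [hG] at this
    · exact (h ⟨s, h1⟩).elim

theorem exists_activated_of_theGeneric_eq_true {n : ℕ} (hG : theGeneric n = true) :
    ∃ s, firstStage activated n s = true := by
  have h : ∃ s, activated n s = true := by
    by_cases h : ∃ s, released n s = true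
    · obtain ⟨s, hs⟩ := h
      exact ⟨s, by rw [activated, hs, Bool.or_true]⟩
    · obtain ⟨s, hs⟩ := (theGeneric_iff h).1 hG
      exact ⟨s, by rw [activated, hs, Bool.true_or]⟩
  obtain ⟨s, hs⟩ := h
  obtain ⟨t, -, ht⟩ := exists_firstStage_le hs
  exact ⟨t, ht⟩

theorem isComputablyCategoricalRelTo_theGeneric :
    IsComputablyCategoricalRelTo theGeneric stdGraph := by
  rintro B ⟨hdec, hB⟩ ⟨Φ⟩
  let r : ℕ → ℕ → Bool := fun x y => decide (B.Adj (x, y).1 (x, y).2)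
  have hr : ComputableIn (oracle theGeneric) fun p : ℕ × ℕ => r p.1 p.2 := hB
  let ψ : B.Adj ≃r fun x y => r x y = true := ⟨Equiv.refl ℕ, by
    intro x y
    exact decide_eq_true_iff⟩
  obtain ⟨f, hf⟩ := exists_computableIn_iso (primrec_firstStage primrec_activated)
    (primrec_firstStage primrec_released) (fun _ _ _ => firstStage_unique)
    (fun _ _ _ => firstStage_unique)
    (fun _ _ h => (exists_activated_of_released h).imp fun _ h => h.1)
    (computableIn_oracle theGeneric)
    (fun _ _ => exists_released_of_theGeneric_eq_false)
    (fun _ => exists_activated_of_theGeneric_eq_true) hr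
    ((gadgetIso _ _ _).symm.trans (Φ.trans ψ))
  exact ⟨(gadgetIso _ _ _).trans (f.trans ψ.symm), hf⟩

/-- Padding: composing a nowhere defined program with itself keeps it nowhere defined and raises its
index. -/
theorem exists_code_not_dom (m : ℕ) : ∃ c : Code, m ≤ encode c ∧ ∀ n x, x ∉ c.eval n := by
  induction m with
  | zero =>
    obtain ⟨c, hc⟩ := Code.exists_code.1 (Partrec.nat_iff.1 (Partrec.none (α := ℕ) (σ := ℕ)))
    exact ⟨c, Nat.zero_le _, fun n x h => by rw [hc] at h; exact Part.notMem_none _ h⟩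
  | succ m ih =>
    obtain ⟨c, hm, hc⟩ := ih
    refine ⟨Code.comp c c, hm.trans_lt (Code.encode_lt_comp c c).1, fun n x h => ?_⟩
    obtain ⟨y, hy, -⟩ := Part.mem_bind_iff.1 h
    exact hc n y hy

theorem exists_never_activated (m : ℕ) : ∃ n ≥ m, ∀ s, activated n s = false := by
  obtain ⟨c, hm, hc⟩ := exists_code_not_dom m
  refine ⟨freezePt (encode c), hm.trans freezePt_strictMono.le_apply, fun s => ?_⟩
  rw [activated, Bool.or_eq_false_iff]
  constructor
  · rw [Option.isSome_eq_false_iff, Option.isNone_iff_eq_none, Option.eq_none_iff_forall_not_mem]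
    intro v hv
    have h := Code.evaln_sound hv
    rw [unpair_freezePt, ofNat_encode] at h
    exact hc _ _ h
  · exact Bool.eq_false_iff.2 fun h => not_released_freezePt _ ⟨s, h⟩

theorem not_isGeneric_two_theGeneric : ¬ IsGeneric 2 theGeneric := by
  intro hgen
  -- `theGeneric` cannot meet `T`, since its ones are all activated; it cannot avoid `T`, since
  -- never activated positions are unbounded.
  let T : Set (List Bool) := {σ | ∃ n, σ[n]? = some true ∧ ∀ s, activated n s = false}
  have hT : IsSigma 2 fun σ => σ ∈ T := by
    refine ⟨fun p => p.1[p.2]? = some true ∧ ∀ s, activated p.2 s = false,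
      ⟨fun x => ¬ x.1.1[x.1.2]? = some true ∨ activated x.1.2 x.2 = true, ?_, fun p => ?_⟩,
      fun σ => Iff.rfl⟩
    · have h1 : PrimrecPred fun x : (List Bool × ℕ) × ℕ => x.1.1[x.1.2]? = some true :=
        Primrec.eq.comp (Primrec.list_getElem?.comp (Primrec.fst.comp Primrec.fst)
          (Primrec.snd.comp Primrec.fst)) (Primrec.const _)
      have h2 : PrimrecPred fun x : (List Bool × ℕ) × ℕ => activated x.1.2 x.2 = true :=
        Primrec.eq.comp (primrec_activated.comp (Primrec.snd.comp Primrec.fst) Primrec.snd)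
          (Primrec.const _)
      exact (h1.not.or h2).not.computablePred
    · simp only [not_and_or, not_forall, Bool.not_eq_false]
      constructor
      · rintro (h | ⟨s, hs⟩)
        · exact ⟨0, Or.inl h⟩
        · exact ⟨s, Or.inr hs⟩
      · rintro ⟨s, h | hs⟩
        · exact Or.inl h
        · exact Or.inr ⟨s, hs⟩
  obtain ⟨m, ⟨n, hn, hna⟩ | h⟩ := hgen T hT
  · have hlt : n < m := by
      have := (List.getElem?_eq_some_iff.1 hn).1
      rwa [length_initSeg] at this
    rw [initSeg_getElem? _ _ _ hlt, Option.some_inj] at hn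
    obtain ⟨s, hs⟩ := exists_activated_of_theGeneric_eq_true hn
    have := (firstStage_iff.1 hs).1
    simp [hna] at this
  · obtain ⟨n, hmn, hna⟩ := exists_never_activated m
    refine h (initSeg theGeneric m ++ (List.replicate (n - m) false ++ [true]))
      (List.prefix_append _ _) ⟨n, ?_, hna⟩
    rw [List.getElem?_append_right (by rw [length_initSeg]; exact hmn), length_initSeg,
      List.getElem?_append_right (by simp)]
    simp

theorem isProperlyOneGeneric_theGeneric : IsProperlyOneGeneric theGeneric :=
  ⟨isGeneric_one_genericSet _, not_isGeneric_two_theGeneric⟩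

end CompCat

theorem mainTheorem1 :
    ∃ G : ℕ → Bool, CompCat.IsProperlyOneGeneric G ∧
      ∃ A : Digraph ℕ, CompCat.IsComputableGraph A ∧
        ¬ CompCat.IsComputablyCategorical A ∧
        CompCat.IsComputablyCategoricalRelTo G A :=
  ⟨CompCat.theGeneric, CompCat.isProperlyOneGeneric_theGeneric, CompCat.stdGraph,
    CompCat.isComputableGraph_stdGraph, CompCat.not_isComputablyCategorical_stdGraph,
    CompCat.isComputablyCategoricalRelTo_theGeneric⟩
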